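/- All Hilbert spaces are finite dimensional. For unit vectors $\psi\in\mathbb C^{a}\otimes\mathbb C^{b}$ and $\varphi\in\mathbb C^{a'}\otimes\mathbb C^{b'}$ write $\psi\to\varphi$ if some LOCC operation $\Lambda$ (the trace-preserving map of a finite protocol of local measurements and classical communication) satisfies $\Lambda(|\psi\rangle\langle\psi|)=|\varphi\rangle\langle\varphi|$. Let $P_S(\psi\to\varphi)$ be the supremum of all $p$ such that some LOCC protocol ending in a declaration of success or failure succeeds on $\psi$ with probability $p$, leaving exactly the state $\varphi$ in that case; that is, its success map sends $|\psi\rangle\langle\psi|$ to $p\,|\varphi\rangle\langle\varphi|$. A Schmidt vector of size $n$ of $\psi$ is a vector $\lambda_1\ge\dots\ge\lambda_n\ge 0$ such that $\psi=\sum_{i=1}^n\sqrt{\lambda_i}\,e_i\otimes f_i$ for orthonormal families $(e_i)$ in $\mathbb C^a$ and $(f_i)$ in $\mathbb C^b$. (1) If the unit vectors $\psi$ and $\varphi$ have Schmidt vectors $\alpha$ and $\beta$ of the same size $n$, then $\psi\to\varphi$ if and only if $P_S(\psi\to\varphi)=1$. (2) Let $\alpha,\beta$ be independent random Schmidt vectors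 of the same size $n$ on a probability space $(\Omega,\mathbb P)$, and for every $\omega\in\Omega$ let $\psi_\omega\in\mathbb C^{a}\otimes\mathbb C^{b}$ and $\varphi_\omega\in\mathbb C^{a'}\otimes\mathbb C^{b'}$ be unit vectors with Schmidt vectors $\alpha(\omega)$ and $\beta(\omega)$. Then $\{\omega:\psi_\omega\to\varphi_\omega\}$ is measurable and equal to $\{\omega: P_S(\psi_\omega\to\varphi_\omega)=1\}$; in particular $$\mathbb P(\psi\to\varphi)=\mathbb P\bigl(P_S(\psi\to\varphi)=1\bigr).$$ -/

import Mathlib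

open scoped Kronecker
open MeasureTheory ProbabilityTheory

noncomputable section

/-- Vectors of the bipartite Hilbert space `ℂᵃ ⊗ ℂᵇ`, written in the product basis. -/
abbrev BipartiteSpace (a b : ℕ) : Type := EuclideanSpace ℂ (Fin a × Fin b)

/-- Operators on `ℂᵃ ⊗ ℂᵇ`. -/
abbrev BipartiteOp (a b : ℕ) : Type := Matrix (Fin a × Fin b) (Fin a × Fin b) ℂ

/-- The operator `|ψ⟩⟨ψ|`. -/
def pureDensity {a b : ℕ} (ψ : BipartiteSpace a b) : BipartiteOp a b :=
  Matrix.of fun x y => ψ x * star (ψ y)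

/-- `IsSchmidtVector v ψ`: the ordered (non-increasing) nonnegative vector `v` of size `n` is a
Schmidt vector of `ψ`, i.e. `ψ = ∑ i, √(v i) • e i ⊗ f i` with `e` orthonormal in `ℂᵃ` and `f`
orthonormal in `ℂᵇ`. Entries of `v` may vanish. -/
def IsSchmidtVector {n a b : ℕ} (v : Fin n → ℝ) (ψ : BipartiteSpace a b) : Prop :=
  Antitone v ∧ (∀ i, 0 ≤ v i) ∧
    ∃ (e : Fin n → EuclideanSpace ℂ (Fin a)) (f : Fin n → EuclideanSpace ℂ (Fin b)),
      Orthonormal ℂ e ∧ Orthonormal ℂ f ∧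
        ∀ x, ψ x = ∑ i, ((Real.sqrt (v i) : ℝ) : ℂ) * (e i x.1 * f i x.2)

/-- `LOCCProtocol O a' b' a b`: a finite protocol of local operations and classical communication
for two parties who start with a system on `ℂᵃ ⊗ ℂᵇ` and end with one on `ℂᵃ' ⊗ ℂᵇ'`, together
with a classical final outcome in `O`.
Either the protocol is over and an outcome is announced, or one party performs a measurement on
its own system, given by Kraus operators `M i` with `∑ i, (M i)ᴴ * M i = 1` (the dimension after
the measurement may depend on the result, so that local ancillas, local unitaries and the
discarding of local systems are included), and communicates the result `i` to the other party;
everything that follows may depend on `i`. -/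
inductive LOCCProtocol (O : Type) (a' b' : ℕ) : ℕ → ℕ → Type
  | done (o : O) : LOCCProtocol O a' b' a' b'
  | alice {a b k : ℕ} (d : Fin k → ℕ) (M : ∀ i, Matrix (Fin (d i)) (Fin a) ℂ)
      (hM : ∑ i, (M i).conjTranspose * M i = 1)
      (next : ∀ i, LOCCProtocol O a' b' (d i) b) : LOCCProtocol O a' b' a b
  | bob {a b k : ℕ} (d : Fin k → ℕ) (M : ∀ i, Matrix (Fin (d i)) (Fin b) ℂ)
      (hM : ∑ i, (M i).conjTranspose * M i = 1)
      (next : ∀ i, LOCCProtocol O a' b' a (d i)) : LOCCProtocol O a' b' a b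

open Classical in
/-- The completely positive, trace non-increasing map that a protocol induces for the final
outcome `o`: the trace of the output is the probability of `o`, and the output is the final
(unnormalised) state in that case. The sum over all branches with outcome `o` forgets the
intermediate measurement results. -/
def LOCCProtocol.branch {O : Type} {a' b' : ℕ} (o : O) :
    {a b : ℕ} → LOCCProtocol O a' b' a b → BipartiteOp a b → BipartiteOp a' b'
  | _, _, .done o', ρ => if o' = o then ρ else 0
  | _, b, .alice _ M _ next, ρ =>
      ∑ i, (next i).branch o
        ((M i ⊗ₖ (1 : Matrix (Fin b) (Fin b) ℂ)) * ρ *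
          (M i ⊗ₖ (1 : Matrix (Fin b) (Fin b) ℂ)).conjTranspose)
  | a, _, .bob _ M _ next, ρ =>
      ∑ i, (next i).branch o
        (((1 : Matrix (Fin a) (Fin a) ℂ) ⊗ₖ M i) * ρ *
          ((1 : Matrix (Fin a) (Fin a) ℂ) ⊗ₖ M i).conjTranspose)

/-- `Λ` is a (deterministic) LOCC operation: the trace preserving map of a protocol with a single
final outcome. -/
def IsLOCC {a b a' b' : ℕ} (Λ : BipartiteOp a b → BipartiteOp a' b') : Prop :=
  ∃ T : LOCCProtocol Unit a' b' a b, Λ = T.branch ()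

/-- `ψ → φ`: some LOCC operation maps `|ψ⟩⟨ψ|` to `|φ⟩⟨φ|`. -/
def Accesses {a b a' b' : ℕ} (ψ : BipartiteSpace a b) (φ : BipartiteSpace a' b') : Prop :=
  ∃ Λ : BipartiteOp a b → BipartiteOp a' b', IsLOCC Λ ∧ Λ (pureDensity ψ) = pureDensity φ

/-- `ψ` can be converted into `φ` by SLOCC with probability `p`: some LOCC protocol that ends with
a declaration of success (`true`) or failure (`false`) succeeds on `ψ` with probability `p`, and
the state is then exactly `φ`. -/
def ConvertsWithProb {a b a' b' : ℕ} (ψ : BipartiteSpace a b) (φ : BipartiteSpace a' b')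
    (p : ℝ) : Prop :=
  ∃ T : LOCCProtocol Bool a' b' a b,
    T.branch true (pureDensity ψ) = (p : ℂ) • pureDensity φ

/-- `P_S(ψ → φ)`: the optimal probability of conversion by SLOCC (for unit vectors, the supremum
of a nonempty subset of `[0, 1]`). -/
def sloccProb {a b a' b' : ℕ} (ψ : BipartiteSpace a b) (φ : BipartiteSpace a' b') : ℝ :=
  sSup {p : ℝ | ConvertsWithProb ψ φ p}

end

open Matrix


/-! Deterministic convertibility and `sloccProb = 1` are both equivalent to majorization: no tail
sum of the target's Schmidt vector exceeds the corresponding tail sum of the source's.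

Necessity: on coefficient matrices every LOCC branch is a sum of maps `X ↦ K X Lᵀ` that cannot raise
rank and jointly do not increase the squared Frobenius norm (`exists_kraus_branch`). By Eckart–Young
the `l`-th tail sum is the squared distance to the matrices of rank at most `l`, so success with
probability `p` forces `p * tailSum l w ≤ tailSum l v` (`mul_tailSum_le_of_branch`). This bound
passes to the supremum over `p`, so an optimal protocol need not be known to exist.

Sufficiency is Nielsen's theorem: Rado's theorem (`exists_perm_mixture`) writes the source vector as
a mixture of permutations of the target vector; Alice measures accordingly and Bob undoes the
permutation (`exists_protocol_of_tailSum_le`).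

Measurability follows because majorization is a countable family of inequalities between measurable
functions. -/

/-- The coefficient matrix of a bipartite vector. -/
def coeffMatrix {a b : ℕ} (ψ : BipartiteSpace a b) : Matrix (Fin a) (Fin b) ℂ :=
  Matrix.of fun x y => ψ (x, y)

/-- The operator `|A⟩⟨A|` of the bipartite vector with coefficient matrix `A`. -/
def rankOneOp {a b : ℕ} (A : Matrix (Fin a) (Fin b) ℂ) : BipartiteOp a b :=
  Matrix.of fun x y => A x.1 x.2 * star (A y.1 y.2)

/-- The square of the Frobenius norm. -/
noncomputable def frobSq {m n : Type*} [Fintype m] [Fintype n] (A : Matrix m n ℂ) : ℝ :=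
  ∑ i, ∑ j, ‖A i j‖ ^ 2

/-! ### Frobenius norm under measurements and isometries -/

section Frobenius

variable {m n k ι : Type*} [Fintype m] [Fintype n] [Fintype k] [Fintype ι]

lemma frobSq_nonneg (A : Matrix m n ℂ) : 0 ≤ frobSq A := by
  unfold frobSq; positivity

lemma frobSq_transpose (A : Matrix m n ℂ) : frobSq Aᵀ = frobSq A := by
  simp only [frobSq, transpose_apply]
  exact Finset.sum_comm

lemma frobSq_smul (c : ℂ) (A : Matrix m n ℂ) : frobSq (c • A) = ‖c‖ ^ 2 * frobSq A := by
  simp [frobSq, mul_pow, Finset.mul_sum]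

lemma ofReal_frobSq (A : Matrix m n ℂ) : (frobSq A : ℂ) = trace (Aᴴ * A) := by
  simp only [frobSq, trace, diag_apply, mul_apply, conjTranspose_apply]
  rw [Finset.sum_comm]
  push_cast
  refine Finset.sum_congr rfl fun i _ => Finset.sum_congr rfl fun j _ => ?_
  rw [mul_comm]
  exact (Complex.mul_conj' _).symm

lemma frobSq_conjTranspose (A : Matrix m n ℂ) : frobSq Aᴴ = frobSq A := by
  simp only [frobSq, conjTranspose_apply, norm_star]
  exact Finset.sum_comm

lemma sum_frobSq_mul [DecidableEq n] {d : ι → Type*} [∀ i, Fintype (d i)]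
    (M : ∀ i, Matrix (d i) n ℂ) (hM : ∑ i, (M i)ᴴ * M i = 1) (X : Matrix n k ℂ) :
    ∑ i, frobSq (M i * X) = frobSq X := by
  have : ((∑ i, frobSq (M i * X) : ℝ) : ℂ) = frobSq X := by
    push_cast
    simp only [ofReal_frobSq, conjTranspose_mul]
    rw [← trace_sum]
    have : ∀ i, Xᴴ * (M i)ᴴ * (M i * X) = Xᴴ * ((M i)ᴴ * M i) * X := fun i => by
      simp only [Matrix.mul_assoc]
    simp only [this]
    rw [← Matrix.sum_mul, ← Matrix.mul_sum, hM, Matrix.mul_one]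
  exact_mod_cast this

lemma sum_frobSq_mul_transpose [DecidableEq n] {d : ι → Type*} [∀ i, Fintype (d i)]
    (M : ∀ i, Matrix (d i) n ℂ) (hM : ∑ i, (M i)ᴴ * M i = 1) (X : Matrix k n ℂ) :
    ∑ i, frobSq (X * (M i)ᵀ) = frobSq X := by
  rw [← frobSq_transpose X, ← sum_frobSq_mul M hM]
  refine Finset.sum_congr rfl fun i _ => ?_
  rw [← frobSq_transpose, transpose_mul, transpose_transpose]

lemma frobSq_isometry_mul [DecidableEq n] {V : Matrix m n ℂ} (hV : Vᴴ * V = 1)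
    (X : Matrix n k ℂ) : frobSq (V * X) = frobSq X := by
  have := sum_frobSq_mul (ι := Unit) (fun _ => V) (by simpa using hV) X
  simpa using this

lemma frobSq_mul_isometry_transpose [DecidableEq n] {V : Matrix m n ℂ} (hV : Vᴴ * V = 1)
    (X : Matrix k n ℂ) : frobSq (X * Vᵀ) = frobSq X := by
  have := sum_frobSq_mul_transpose (ι := Unit) (fun _ => V) (by simpa using hV) X
  simpa using this

lemma one_sub_isometry_conjTranspose_mul [DecidableEq n] [DecidableEq m] {V : Matrix m n ℂ}
    (hV : Vᴴ * V = 1) : (1 - V * Vᴴ)ᴴ * (1 - V * Vᴴ) = 1 - V * Vᴴ := by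
  have : V * Vᴴ * (V * Vᴴ) = V * Vᴴ := by
    rw [Matrix.mul_assoc, ← Matrix.mul_assoc Vᴴ, hV, Matrix.one_mul]
  simp [Matrix.sub_mul, Matrix.mul_sub, this]

/-- Pythagoras for the range of `V` and its orthogonal complement. -/
lemma frobSq_eq_add_of_isometry [DecidableEq n] [DecidableEq m] {V : Matrix m n ℂ}
    (hV : Vᴴ * V = 1) (X : Matrix m k ℂ) :
    frobSq X = frobSq (Vᴴ * X) + frobSq ((1 - V * Vᴴ) * X) := by
  have : (frobSq X : ℂ) = ((frobSq (Vᴴ * X) + frobSq ((1 - V * Vᴴ) * X) : ℝ) : ℂ) := by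
    push_cast
    simp only [ofReal_frobSq, conjTranspose_mul (_ : Matrix _ _ ℂ) X]
    rw [← trace_add]
    congr 1
    rw [Matrix.mul_assoc Xᴴ (1 - V * Vᴴ)ᴴ, ← Matrix.mul_assoc (1 - V * Vᴴ)ᴴ,
      one_sub_isometry_conjTranspose_mul hV, conjTranspose_conjTranspose]
    simp [Matrix.mul_assoc, Matrix.sub_mul, Matrix.mul_sub]
  exact_mod_cast this

end Frobenius

/-! ### Kraus form of LOCC branches -/

section Kraus

lemma kronecker_mul_rankOneOp {a b a' b' : ℕ} (M : Matrix (Fin a') (Fin a) ℂ)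
    (N : Matrix (Fin b') (Fin b) ℂ) (A : Matrix (Fin a) (Fin b) ℂ) :
    (M ⊗ₖ N) * rankOneOp A * (M ⊗ₖ N)ᴴ = rankOneOp (M * A * Nᵀ) := by
  have h : ∀ A : Matrix (Fin a) (Fin b) ℂ, rankOneOp A =
      vecMulVec (fun x => A x.1 x.2) (star fun x => A x.1 x.2) := fun A => rfl
  have h' : ∀ A : Matrix (Fin a') (Fin b') ℂ, rankOneOp A =
      vecMulVec (fun x => A x.1 x.2) (star fun x => A x.1 x.2) := fun A => rfl
  have hv : (M ⊗ₖ N) *ᵥ (fun x => A x.1 x.2) = fun x => (M * A * Nᵀ) x.1 x.2 := by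
    ext ⟨x, y⟩
    simp only [mulVec, dotProduct, kroneckerMap_apply, mul_apply, transpose_apply,
      Fintype.sum_prod_type, Finset.sum_mul]
    rw [Finset.sum_comm]
    exact Finset.sum_congr rfl fun i _ => Finset.sum_congr rfl fun j _ => by ring
  rw [h, h', mul_vecMulVec, vecMulVec_mul, ← star_mulVec, hv]

/-- Kraus operators compose along each path of the protocol tree. A complete measurement preserves
the total squared norm; only paths ending in another outcome lose some. The bound is for every `X`
because it is later applied to the source minus a low-rank truncation. -/
lemma exists_kraus_branch {O : Type} {a' b' : ℕ} (o : O) {a b : ℕ}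
    (T : LOCCProtocol O a' b' a b) :
    ∃ (ι : Type) (_ : Fintype ι) (K : ι → Matrix (Fin a') (Fin a) ℂ)
      (L : ι → Matrix (Fin b') (Fin b) ℂ),
      (∀ A, T.branch o (rankOneOp A) = ∑ j, rankOneOp (K j * A * (L j)ᵀ)) ∧
      ∀ X : Matrix (Fin a) (Fin b) ℂ, ∑ j, frobSq (K j * X * (L j)ᵀ) ≤ frobSq X := by
  induction T with
  | done o' =>
    by_cases h : o' = o
    · exact ⟨Unit, inferInstance, fun _ => 1, fun _ => 1, by simp [LOCCProtocol.branch, h],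
        by simp⟩
    · exact ⟨Empty, inferInstance, fun _ => 1, fun _ => 1, by simp [LOCCProtocol.branch, h],
        by simp [frobSq_nonneg]⟩
  | alice d M hM next ih =>
    choose ι hι K L h1 h2 using ih
    refine ⟨Σ i, ι i, inferInstance, fun j => K j.1 j.2 * M j.1, fun j => L j.1 j.2, ?_, ?_⟩
    · intro A
      rw [LOCCProtocol.branch, Fintype.sum_sigma]
      refine Finset.sum_congr rfl fun i _ => ?_
      rw [kronecker_mul_rankOneOp, h1]
      simp [Matrix.mul_assoc]
    · intro X
      rw [Fintype.sum_sigma, ← sum_frobSq_mul M hM X]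
      refine Finset.sum_le_sum fun i _ => ?_
      refine le_trans (le_of_eq ?_) (h2 i _)
      simp [Matrix.mul_assoc]
  | bob d M hM next ih =>
    choose ι hι K L h1 h2 using ih
    refine ⟨Σ i, ι i, inferInstance, fun j => K j.1 j.2, fun j => L j.1 j.2 * M j.1, ?_, ?_⟩
    · intro A
      rw [LOCCProtocol.branch, Fintype.sum_sigma]
      refine Finset.sum_congr rfl fun i _ => ?_
      rw [kronecker_mul_rankOneOp, h1]
      simp [Matrix.mul_assoc]
    · intro X
      rw [Fintype.sum_sigma, ← sum_frobSq_mul_transpose M hM X]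
      refine Finset.sum_le_sum fun i _ => ?_
      refine le_trans (le_of_eq ?_) (h2 i _)
      simp [Matrix.mul_assoc]

/-- A mixture of vectors that is proportional to a pure state consists of multiples of it. -/
lemma eq_smul_of_sum_rankOneOp {ι : Type*} [Fintype ι] {a b : ℕ}
    {C : ι → Matrix (Fin a) (Fin b) ℂ} {Φ : Matrix (Fin a) (Fin b) ℂ} (hΦ : Φ ≠ 0) {p : ℝ}
    (h : ∑ j, rankOneOp (C j) = (p : ℂ) • rankOneOp Φ) :
    ∃ c : ι → ℂ, (∀ j, C j = c j • Φ) ∧ ∑ j, ‖c j‖ ^ 2 = p := by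
  have he : ∀ x y : Fin a × Fin b, ∑ j, C j x.1 x.2 * star (C j y.1 y.2) =
      p * (Φ x.1 x.2 * star (Φ y.1 y.2)) := fun x y => by
    have := congrFun (congrFun h x) y
    simpa [Matrix.sum_apply, rankOneOp] using this
  obtain ⟨x, y, hxy⟩ : ∃ x y, Φ x y ≠ 0 := by
    by_contra! h0
    exact hΦ (by ext x y; simp [h0])
  -- Proportionality means vanishing 2×2 minors. Their squared moduli, summed over `j`, expand into
  -- four entries of the mixture, which cancel by `he`.
  have hz : ∀ j s t, Φ x y * C j s t = Φ s t * C j x y := by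
    intro j s t
    have h0 : ((∑ j, ‖Φ x y * C j s t - Φ s t * C j x y‖ ^ 2 : ℝ) : ℂ) = 0 := by
      push_cast
      have : ∀ j, (‖Φ x y * C j s t - Φ s t * C j x y‖ : ℂ) ^ 2 =
          Φ x y * star (Φ x y) * (C j s t * star (C j s t))
          - Φ x y * star (Φ s t) * (C j s t * star (C j x y))
          - Φ s t * star (Φ x y) * (C j x y * star (C j s t))
          + Φ s t * star (Φ s t) * (C j x y * star (C j x y)) := fun j => by
        rw [← Complex.mul_conj']
        simp only [map_sub, map_mul, Complex.star_def]
        ring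
      simp only [this, Finset.sum_add_distrib, Finset.sum_sub_distrib, ← Finset.mul_sum]
      rw [he (s, t) (s, t), he (s, t) (x, y), he (x, y) (s, t), he (x, y) (x, y)]
      ring
    have h1 : ∑ j, ‖Φ x y * C j s t - Φ s t * C j x y‖ ^ 2 = 0 := by exact_mod_cast h0
    rw [Finset.sum_eq_zero_iff_of_nonneg (fun _ _ => by positivity)] at h1
    have := h1 j (Finset.mem_univ _)
    rw [← sub_eq_zero]
    simpa using this
  refine ⟨fun j => C j x y / Φ x y, fun j => ?_, ?_⟩
  · ext s t
    rw [Matrix.smul_apply, smul_eq_mul, div_mul_eq_mul_div, eq_div_iff hxy, mul_comm, hz]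
    ring
  · have := he (x, y) (x, y)
    simp only [Complex.star_def, Complex.mul_conj'] at this
    have h2 : ∑ j, ‖C j x y‖ ^ 2 = p * ‖Φ x y‖ ^ 2 := by exact_mod_cast this
    have h3 : ‖Φ x y‖ ^ 2 ≠ 0 := by simpa using hxy
    simp only [norm_div, div_pow, ← Finset.sum_div]
    rw [h2, mul_div_cancel_right₀ _ h3]

end Kraus

/-! ### Tail sums, Schmidt decompositions and low-rank approximation -/

/-- The sum of the entries of `v` with index at least `l`. -/
def tailSum {n : ℕ} (l : ℕ) (v : Fin n → ℝ) : ℝ :=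
  ∑ i, if l ≤ i.val then v i else 0

lemma tailSum_zero {n : ℕ} (v : Fin n → ℝ) : tailSum 0 v = ∑ i, v i := by
  simp [tailSum]

lemma tailSum_nonneg {n : ℕ} (l : ℕ) {v : Fin n → ℝ} (hv : ∀ i, 0 ≤ v i) : 0 ≤ tailSum l v :=
  Finset.sum_nonneg fun i _ => by split_ifs <;> simp [hv]

/-- The coefficient matrix of `∑ i, √(v i) • e i ⊗ f i`, the columns of `E` and `F` being `e`
and `f`. -/
noncomputable def schmidtMatrix {n a b : ℕ} (v : Fin n → ℝ) (E : Matrix (Fin a) (Fin n) ℂ)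
    (F : Matrix (Fin b) (Fin n) ℂ) : Matrix (Fin a) (Fin b) ℂ :=
  E * diagonal (fun i => ((Real.sqrt (v i) : ℝ) : ℂ)) * Fᵀ

lemma conjTranspose_mul_self_of_orthonormal {n a : ℕ} {e : Fin n → EuclideanSpace ℂ (Fin a)}
    (he : Orthonormal ℂ e) :
    (Matrix.of fun x i => e i x : Matrix (Fin a) (Fin n) ℂ)ᴴ * Matrix.of (fun x i => e i x) = 1 := by
  ext i j
  rw [orthonormal_iff_ite] at he
  have := he i j
  rw [PiLp.inner_apply] at this
  simp only [mul_apply, conjTranspose_apply, of_apply, one_apply]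
  rw [← this]
  exact Finset.sum_congr rfl fun x _ => by simp [mul_comm]

lemma IsSchmidtVector.exists_matrix {n a b : ℕ} {v : Fin n → ℝ} {ψ : BipartiteSpace a b}
    (h : IsSchmidtVector v ψ) :
    ∃ (E : Matrix (Fin a) (Fin n) ℂ) (F : Matrix (Fin b) (Fin n) ℂ),
      Eᴴ * E = 1 ∧ Fᴴ * F = 1 ∧ coeffMatrix ψ = schmidtMatrix v E F := by
  obtain ⟨-, -, e, f, he, hf, h⟩ := h
  refine ⟨_, _, conjTranspose_mul_self_of_orthonormal he,
    conjTranspose_mul_self_of_orthonormal hf, ?_⟩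
  ext x y
  rw [schmidtMatrix, mul_apply]
  simp only [coeffMatrix, of_apply, h, mul_diagonal, transpose_apply]
  exact Finset.sum_congr rfl fun i _ => by ring

lemma frobSq_diagonal {n : ℕ} (s : Fin n → ℂ) : frobSq (diagonal s) = ∑ i, ‖s i‖ ^ 2 := by
  simp only [frobSq, diagonal_apply]
  refine Finset.sum_congr rfl fun i _ => ?_
  rw [Finset.sum_eq_single i] <;> simp +contextual [eq_comm]

lemma frobSq_isometry_diagonal {n a b : ℕ} {E : Matrix (Fin a) (Fin n) ℂ}
    {F : Matrix (Fin b) (Fin n) ℂ} (hE : Eᴴ * E = 1) (hF : Fᴴ * F = 1) (s : Fin n → ℂ) :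
    frobSq (E * diagonal s * Fᵀ) = ∑ i, ‖s i‖ ^ 2 := by
  rw [frobSq_mul_isometry_transpose hF, frobSq_isometry_mul hE, frobSq_diagonal]

lemma frobSq_schmidtMatrix {n a b : ℕ} {v : Fin n → ℝ} (hv : ∀ i, 0 ≤ v i)
    {E : Matrix (Fin a) (Fin n) ℂ} {F : Matrix (Fin b) (Fin n) ℂ}
    (hE : Eᴴ * E = 1) (hF : Fᴴ * F = 1) : frobSq (schmidtMatrix v E F) = ∑ i, v i := by
  rw [schmidtMatrix, frobSq_isometry_diagonal hE hF]
  exact Finset.sum_congr rfl fun i _ => by simp [Real.sq_sqrt (hv i)]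

lemma norm_sq_eq_frobSq {a b : ℕ} (ψ : BipartiteSpace a b) : ‖ψ‖ ^ 2 = frobSq (coeffMatrix ψ) := by
  rw [EuclideanSpace.norm_sq_eq, Fintype.sum_prod_type]
  rfl

/-- Truncating a Schmidt decomposition to its `l` largest terms. -/
lemma exists_rank_le_frobSq_sub_eq {n a b : ℕ} {v : Fin n → ℝ} (hv : ∀ i, 0 ≤ v i)
    {E : Matrix (Fin a) (Fin n) ℂ} {F : Matrix (Fin b) (Fin n) ℂ}
    (hE : Eᴴ * E = 1) (hF : Fᴴ * F = 1) (l : ℕ) :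
    ∃ B : Matrix (Fin a) (Fin b) ℂ, B.rank ≤ l ∧ frobSq (schmidtMatrix v E F - B) = tailSum l v := by
  refine ⟨E * diagonal (fun i => if l ≤ i.val then 0 else ((Real.sqrt (v i) : ℝ) : ℂ)) * Fᵀ, ?_, ?_⟩
  · refine (rank_mul_le_left _ _).trans ((rank_mul_le_right _ _).trans ?_)
    rw [rank_diagonal, Fintype.card_subtype]
    refine le_trans (Finset.card_le_card_of_injOn (t := Finset.range l) (fun i => i.val) ?_
      Fin.val_injective.injOn) (by simp)
    intro i hi
    simp only [Finset.coe_filter, Set.mem_ofPred_eq] at hi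
    simp only [Finset.coe_range, Set.mem_Iio]
    by_contra hl
    simp [not_lt.mp hl] at hi
  · rw [schmidtMatrix, ← Matrix.sub_mul, ← Matrix.mul_sub, diagonal_sub,
      frobSq_isometry_diagonal hE hF, tailSum]
    refine Finset.sum_congr rfl fun i _ => ?_
    split_ifs <;> simp [Real.sq_sqrt (hv i)]

lemma exists_isometry_mul_eq {a b : ℕ} (D : Matrix (Fin a) (Fin b) ℂ) :
    ∃ G : Matrix (Fin a) (Fin D.rank) ℂ, Gᴴ * G = 1 ∧ G * Gᴴ * D = D := by
  let S : Submodule ℂ (EuclideanSpace ℂ (Fin a)) := LinearMap.range (toEuclideanLin D)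
  have hS : Module.finrank ℂ S = D.rank := by
    rw [rank_eq_finrank_range_toLin D (EuclideanSpace.basisFun _ ℂ).toBasis
      (EuclideanSpace.basisFun _ ℂ).toBasis]
    rfl
  let g := (stdOrthonormalBasis ℂ S).reindex (finCongr hS)
  have hg : Orthonormal ℂ fun i => (g i : EuclideanSpace ℂ (Fin a)) :=
    g.orthonormal.comp_linearIsometry S.subtypeₗᵢ
  refine ⟨_, conjTranspose_mul_self_of_orthonormal hg, ?_⟩
  ext x y
  let u : S := ⟨WithLp.toLp 2 fun x => D x y, by
    refine ⟨EuclideanSpace.single y 1, ?_⟩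
    ext z
    simp [toLpLin_apply]⟩
  have := congrArg (fun s : S => (s : EuclideanSpace ℂ (Fin a)) x) (g.sum_repr' u)
  simp only [u] at this
  rw [Matrix.mul_assoc, mul_apply]
  refine Eq.trans ?_ this
  simp only [mul_apply, of_apply, conjTranspose_apply, Submodule.coe_sum,
    Submodule.coe_smul, WithLp.ofLp_sum, WithLp.ofLp_smul, Finset.sum_apply, Pi.smul_apply,
    smul_eq_mul, Submodule.coe_inner, PiLp.inner_apply]
  refine Finset.sum_congr rfl fun i _ => ?_
  rw [mul_comm]
  congr 1
  exact Finset.sum_congr rfl fun z _ => by simp [mul_comm]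

/-- With total weight at most `l` and each weight at most 1, it is best to fill the `l` largest
entries. Comparing with the threshold `w l`, each `(w i - w l) * (t i - 1_{i < l})` is nonpositive.
-/
lemma sum_mul_le_sum_of_antitone {n l : ℕ} {w t : Fin n → ℝ} (hw : Antitone w)
    (hw0 : ∀ i, 0 ≤ w i) (ht0 : ∀ i, 0 ≤ t i) (ht1 : ∀ i, t i ≤ 1) (hl : ∑ i, t i ≤ l) :
    ∑ i, w i * t i ≤ ∑ i, if l ≤ i.val then 0 else w i := by
  rcases le_or_gt n l with h | h
  · refine Finset.sum_le_sum fun i _ => ?_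
    rw [if_neg (by omega)]
    exact mul_le_of_le_one_right (hw0 i) (ht1 i)
  · set k := w ⟨l, h⟩ with hk
    have hcard : ∑ i : Fin n, (if l ≤ i.val then (0 : ℝ) else 1) = l := by
      rw [Fin.sum_univ_eq_sum_range (fun i => if l ≤ i then (0 : ℝ) else 1),
        ← Finset.sum_range_add_sum_Ico _ h.le, Finset.sum_congr rfl
          (fun i hi => if_neg (by simpa using hi)), Finset.sum_congr rfl
          (fun i hi => if_pos (Finset.mem_Ico.mp hi).1)]
      simp
    have key : ∀ i, w i * t i ≤ (if l ≤ i.val then 0 else w i) +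
        k * (t i - if l ≤ i.val then 0 else 1) := by
      intro i
      split_ifs with hi
      · have : w i ≤ k := hw (Fin.mk_le_of_le_val hi)
        nlinarith [ht0 i]
      · have : k ≤ w i := hw (by rw [Fin.le_def]; simp; omega)
        nlinarith [ht1 i]
    refine (Finset.sum_le_sum fun i _ => key i).trans ?_
    rw [Finset.sum_add_distrib, ← Finset.mul_sum, Finset.sum_sub_distrib, hcard]
    nlinarith [hw0 ⟨l, h⟩]

/-- Low rank approximations of a Schmidt decomposition (Eckart–Young). -/
lemma tailSum_le_frobSq_sub {n a b : ℕ} {w : Fin n → ℝ} (hw : Antitone w) (hw0 : ∀ i, 0 ≤ w i)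
    {E : Matrix (Fin a) (Fin n) ℂ} {F : Matrix (Fin b) (Fin n) ℂ}
    (hE : Eᴴ * E = 1) (hF : Fᴴ * F = 1) {l : ℕ} {D : Matrix (Fin a) (Fin b) ℂ} (hD : D.rank ≤ l) :
    tailSum l w ≤ frobSq (schmidtMatrix w E F - D) := by
  obtain ⟨G, hG, hGD⟩ := exists_isometry_mul_eq D
  -- `t i` is the squared length of the projection of the `i`-th Schmidt vector onto the range of
  -- `D`; hence each is at most 1 and they sum to at most `D.rank`.
  set t : Fin n → ℝ := fun i => ∑ k, ‖(Gᴴ * E) k i‖ ^ 2 with ht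
  have h1 : frobSq (schmidtMatrix w E F) - frobSq (Gᴴ * schmidtMatrix w E F) ≤
      frobSq (schmidtMatrix w E F - D) := by
    have h0 : (1 - G * Gᴴ) * D = 0 := by rw [Matrix.sub_mul, hGD, Matrix.one_mul, sub_self]
    have := frobSq_eq_add_of_isometry hG (schmidtMatrix w E F - D)
    rw [Matrix.mul_sub (1 - G * Gᴴ), h0, sub_zero] at this
    have h2 := frobSq_eq_add_of_isometry hG (schmidtMatrix w E F)
    linarith [frobSq_nonneg (Gᴴ * (schmidtMatrix w E F - D))]
  have h2 : frobSq (Gᴴ * schmidtMatrix w E F) = ∑ i, w i * t i := by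
    rw [schmidtMatrix, ← Matrix.mul_assoc, frobSq_mul_isometry_transpose hF, ← Matrix.mul_assoc,
      frobSq, Finset.sum_comm]
    refine Finset.sum_congr rfl fun i _ => ?_
    simp only [mul_diagonal, norm_mul, mul_pow, ht, Finset.mul_sum]
    exact Finset.sum_congr rfl fun k _ => by simp [Real.sq_sqrt (hw0 i), mul_comm]
  have ht0 : ∀ i, 0 ≤ t i := fun i => by positivity
  have ht1 : ∀ i, t i ≤ 1 := by
    intro i
    -- Multiplication by this one-column matrix extracts column `i` of `E`.
    have := frobSq_eq_add_of_isometry hG (E * Matrix.single i () (1 : ℂ))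
    rw [frobSq_isometry_mul hE, ← Matrix.mul_assoc] at this
    have hs : ∀ {c : ℕ} (M : Matrix (Fin c) (Fin n) ℂ),
        frobSq (M * Matrix.single i () (1 : ℂ)) = ∑ k, ‖M k i‖ ^ 2 := by
      intro c M
      simp [frobSq]
    have h1 := hs (1 : Matrix (Fin n) (Fin n) ℂ)
    rw [Matrix.one_mul] at h1
    rw [hs, h1] at this
    have h3 : ∑ k, ‖(1 : Matrix (Fin n) (Fin n) ℂ) k i‖ ^ 2 = 1 := by
      rw [Finset.sum_eq_single i] <;> simp +contextual
    have h4 := frobSq_nonneg ((1 - G * Gᴴ) * (E * Matrix.single i () (1 : ℂ)))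
    simp only [ht]
    linarith
  have htl : ∑ i, t i ≤ l := by
    have h3 : ∑ i, t i = frobSq (Eᴴ * G) := by
      rw [← frobSq_conjTranspose, conjTranspose_mul, conjTranspose_conjTranspose, frobSq,
        Finset.sum_comm]
    have h4 := frobSq_eq_add_of_isometry hE G
    have h5 : frobSq G = D.rank := by
      have := frobSq_isometry_mul hG (1 : Matrix (Fin D.rank) (Fin D.rank) ℂ)
      rw [Matrix.mul_one] at this
      rw [this, ← diagonal_one, frobSq_diagonal]
      simp
    have h6 := frobSq_nonneg ((1 - E * Eᴴ) * G)
    have : (D.rank : ℝ) ≤ l := by exact_mod_cast hD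
    linarith
  have h3 := sum_mul_le_sum_of_antitone hw hw0 ht0 ht1 htl
  have h4 : tailSum l w + (∑ i, if l ≤ i.val then 0 else w i) = ∑ i, w i := by
    rw [tailSum, ← Finset.sum_add_distrib]
    exact Finset.sum_congr rfl fun i _ => by split_ifs <;> simp
  rw [frobSq_schmidtMatrix hw0 hE hF] at h1
  linarith

/-- The tail sums of the Schmidt vector are entanglement monotones. -/
lemma mul_tailSum_le_of_branch {O : Type} {n m a b a' b' : ℕ} {o : O}
    {T : LOCCProtocol O a' b' a b} {v : Fin n → ℝ} {w : Fin m → ℝ} {ψ : BipartiteSpace a b}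
    {φ : BipartiteSpace a' b'} (hφ : ‖φ‖ = 1) (hv : IsSchmidtVector v ψ)
    (hw : IsSchmidtVector w φ) {p : ℝ}
    (h : T.branch o (pureDensity ψ) = (p : ℂ) • pureDensity φ) (l : ℕ) :
    p * tailSum l w ≤ tailSum l v := by
  obtain ⟨ι, _, K, L, hb, hle⟩ := exists_kraus_branch o T
  obtain ⟨E, F, hE, hF, hψE⟩ := hv.exists_matrix
  obtain ⟨E', F', hE', hF', hφE⟩ := hw.exists_matrix
  have hφ0 : coeffMatrix φ ≠ 0 := by
    intro h0
    have := norm_sq_eq_frobSq φ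
    rw [hφ, h0] at this
    simp [frobSq] at this
  have h' : ∑ j, rankOneOp (K j * coeffMatrix ψ * (L j)ᵀ) = (p : ℂ) • rankOneOp (coeffMatrix φ) :=
    (hb (coeffMatrix ψ)).symm.trans h
  obtain ⟨c, hc, rfl⟩ := eq_smul_of_sum_rankOneOp hφ0 h'
  obtain ⟨B, hB, hBv⟩ := exists_rank_le_frobSq_sub_eq hv.2.1 hE hF l
  rw [← hBv, ← hψE]
  refine le_trans ?_ (hle _)
  rw [Finset.sum_mul]
  refine Finset.sum_le_sum fun j _ => ?_
  -- The image of the truncation error is `c j` times the target minus a matrix of rank at most `l`,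
  -- so Eckart–Young bounds it below.
  rw [Matrix.mul_sub, Matrix.sub_mul, hc j]
  rcases eq_or_ne (c j) 0 with h0 | h0
  · simp only [h0, norm_zero]
    simpa using frobSq_nonneg _
  · have : c j • coeffMatrix φ - K j * B * (L j)ᵀ =
        c j • (coeffMatrix φ - (c j)⁻¹ • (K j * B * (L j)ᵀ)) := by
      rw [smul_sub, smul_smul, mul_inv_cancel₀ h0, one_smul]
    rw [this, frobSq_smul, hφE]
    refine mul_le_mul_of_nonneg_left ?_ (by positivity)
    refine tailSum_le_frobSq_sub hw.1 hw.2.1 hE' hF' ?_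
    rw [← smul_mul, ← smul_mul]
    refine (rank_mul_le_left _ _).trans ((rank_mul_le_right _ _).trans hB)

/-! ### Majorization and Rado's theorem -/

/-- Abel summation by induction. Replacing `K` by `c 0` on the remaining indices leaves `(c 0 - K)`
times the full sum of `d`, a product of two nonpositive numbers. -/
lemma sum_sub_mul_nonneg_of_tailSum_nonpos {n : ℕ} {c d : Fin n → ℝ} (hc : Antitone c) {K : ℝ}
    (hK : ∀ i, c i ≤ K) (hd : ∀ l, tailSum l d ≤ 0) : 0 ≤ ∑ i, (c i - K) * d i := by
  induction n generalizing K with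
  | zero => simp
  | succ n ih =>
    have h1 := ih (c := fun i => c i.succ) (d := fun i => d i.succ) (K := c 0)
      (fun i j hij => hc (Fin.succ_le_succ_iff.mpr hij)) (fun i => hc (Fin.zero_le _)) (fun l => by
        have := hd (l + 1)
        rw [tailSum, Fin.sum_univ_succ] at this
        simpa [tailSum] using this)
    have h2 := hd 0
    rw [tailSum_zero, Fin.sum_univ_succ] at h2
    have h3 : ∑ i : Fin n, (c i.succ - K) * d i.succ =
        ∑ i : Fin n, (c i.succ - c 0) * d i.succ + (c 0 - K) * ∑ i : Fin n, d i.succ := by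
      rw [Finset.mul_sum, ← Finset.sum_add_distrib]
      exact Finset.sum_congr rfl fun i _ => by ring
    rw [Fin.sum_univ_succ, h3]
    nlinarith [hK 0]

/-- A vector majorized by `w` is a convex combination of permutations of `w` (Rado). -/
lemma exists_perm_mixture {n : ℕ} {v w : Fin n → ℝ} (hv : Antitone v)
    (h : ∀ l, tailSum l w ≤ tailSum l v) (hs : ∑ i, v i = ∑ i, w i) :
    ∃ (k : ℕ) (p : Fin k → ℝ) (σ : Fin k → Equiv.Perm (Fin n)),
      (∀ s, 0 ≤ p s) ∧ ∑ s, p s = 1 ∧ ∀ i, ∑ s, p s * w (σ s i) = v i := by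
  have hmem : v ∈ convexHull ℝ (Set.range fun σ : Equiv.Perm (Fin n) => w ∘ σ) := by
    by_contra hcon
    obtain ⟨f, u, hf, hu⟩ := geometric_hahn_banach_closed_point (convex_convexHull ℝ _)
      ((Set.finite_range fun σ : Equiv.Perm (Fin n) => w ∘ σ).isCompact_convexHull ℝ).isClosed hcon
    set c : Fin n → ℝ := fun i => f (Pi.single i 1) with hc
    have hfx : ∀ x, f x = ∑ i, c i * x i := by
      intro x
      conv_lhs => rw [pi_eq_sum_univ' x]
      simp [hc, mul_comm]
    -- Sort the separating functional decreasingly. Rearrangement and then majorization bound `f v`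
    -- by the value of `f` at a permutation of `w`, contradicting separation.
    set τ := Tuple.sort (-c)
    have hanti : Antitone (c ∘ τ) := fun i j hij => by
      have := Tuple.monotone_sort (-c) hij
      simpa using this
    have h1 : ∑ i, c i * v i ≤ ∑ i, (c ∘ τ) i * v i := by
      have := (hanti.monovary hv).sum_comp_perm_mul_le_sum_mul (σ := τ⁻¹)
      simpa using this
    have h2 : ∑ i, (c ∘ τ) i * v i ≤ ∑ i, (c ∘ τ) i * w i := by
      have := sum_sub_mul_nonneg_of_tailSum_nonpos (d := fun i => w i - v i) hanti
        -- Any upper bound works, as the `K` terms cancel by `hs`; this one also makes sense for `n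
        -- = 0`.
        (K := ∑ j, |(c ∘ τ) j|)
        (fun i => (le_abs_self _).trans (Finset.single_le_sum (f := fun j => |(c ∘ τ) j|)
          (fun _ _ => abs_nonneg _) (Finset.mem_univ i)))
        (fun l => by
          have := h l
          have h3 : tailSum l (fun i => w i - v i) = tailSum l w - tailSum l v := by
            rw [tailSum, tailSum, tailSum, ← Finset.sum_sub_distrib]
            exact Finset.sum_congr rfl fun i _ => by split_ifs <;> simp
          linarith)
      simp only [sub_mul, Finset.sum_sub_distrib, ← Finset.mul_sum, mul_sub, hs] at this
      linarith
    have h3 : ∑ i, (c ∘ τ) i * w i = f (w ∘ (τ⁻¹ : Equiv.Perm (Fin n))) := by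
      rw [hfx, ← Equiv.sum_comp τ fun i => c i * _]
      simp
    have h4 := hf _ (subset_convexHull ℝ _ ⟨τ⁻¹, rfl⟩)
    rw [hfx v] at hu
    linarith
  obtain ⟨ι, _, p, z, hp, hp1, hz, hsum⟩ := mem_convexHull_iff_exists_fintype.1 hmem
  choose σ hσ using hz
  let e := (Fintype.equivFin ι).symm
  refine ⟨_, p ∘ e, σ ∘ e, fun s => hp _, by rw [← hp1]; exact e.sum_comp p, fun i => ?_⟩
  rw [← hsum, Finset.sum_apply, ← e.sum_comp]
  exact Finset.sum_congr rfl fun s _ => by simp [← hσ]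

/-! ### Nielsen's protocol -/

/-- A complete family of Kraus operators that act as `X s` on the subspace with isometric frame
`E`, up to operators that vanish on the part of it cut out by `P`. -/
lemma exists_kraus_completion {n k a a' : ℕ} (ha' : 0 < a') {E : Matrix (Fin a) (Fin n) ℂ}
    (hE : Eᴴ * E = 1) {E' : Matrix (Fin a') (Fin n) ℂ} (hE' : E'ᴴ * E' = 1)
    (X : Fin k → Matrix (Fin n) (Fin n) ℂ) {P : Matrix (Fin n) (Fin n) ℂ} (hP : Pᴴ = P)
    (hPP : P * P = P) (hX : ∑ s, (X s)ᴴ * X s = P) :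
    ∃ N : Fin (k + a) → Matrix (Fin a') (Fin a) ℂ, ∑ i, (N i)ᴴ * N i = 1 ∧
      (∀ s, N (Fin.castAdd a s) * E = E' * X s) ∧ ∀ x, N (Fin.natAdd k x) * (E * P) = 0 := by
  set Q : Matrix (Fin a) (Fin a) ℂ := 1 - E * P * Eᴴ with hQ
  have hQE : Q * (E * P) = 0 := by
    rw [hQ, Matrix.sub_mul, Matrix.one_mul, Matrix.mul_assoc, ← Matrix.mul_assoc Eᴴ, hE,
      Matrix.one_mul, Matrix.mul_assoc, hPP, sub_self]
  have hQQ : Qᴴ * Q = Q := by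
    have h1 : Qᴴ = Q := by simp [hQ, hP, Matrix.mul_assoc]
    rw [h1]
    nth_rw 2 [hQ]
    rw [Matrix.mul_sub, ← Matrix.mul_assoc, hQE]
    simp
  -- The first `k` operators contribute `E P Eᴴ`. The missing projection `Q` is supplied by the `a`
  -- operators `|0⟩⟨x| Q`, which have the same output dimension.
  refine ⟨Fin.append (fun s => E' * X s * Eᴴ) fun x =>
    Matrix.single (⟨0, ha'⟩ : Fin a') x (1 : ℂ) * Q, ?_, ?_, ?_⟩
  · rw [Fin.sum_univ_add]
    simp only [Fin.append_left, Fin.append_right, conjTranspose_mul, conjTranspose_conjTranspose]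
    have h1 : ∀ s, E * ((X s)ᴴ * E'ᴴ) * (E' * X s * Eᴴ) = E * ((X s)ᴴ * X s) * Eᴴ := fun s => by
      have : E * ((X s)ᴴ * E'ᴴ) * (E' * X s * Eᴴ) = E * (X s)ᴴ * (E'ᴴ * E') * X s * Eᴴ := by
        simp only [Matrix.mul_assoc]
      rw [this, hE']
      simp [Matrix.mul_assoc]
    have h2 : ∀ x : Fin a, Qᴴ * (Matrix.single (⟨0, ha'⟩ : Fin a') x (1 : ℂ))ᴴ *
        (Matrix.single (⟨0, ha'⟩ : Fin a') x (1 : ℂ) * Q) = Qᴴ * Matrix.single x x 1 * Q := fun x => by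
      rw [Matrix.mul_assoc, ← Matrix.mul_assoc _ (Matrix.single _ _ _) Q, conjTranspose_single,
        star_one, Matrix.single_mul_single_same, one_mul, Matrix.mul_assoc]
    simp only [h1, h2]
    rw [← Matrix.sum_mul, ← Matrix.mul_sum, hX, ← Matrix.sum_mul, ← Matrix.mul_sum,
      Matrix.sum_single_one, Matrix.mul_one, hQQ, hQ]
    abel
  · intro s
    rw [Fin.append_left, Matrix.mul_assoc, hE, Matrix.mul_one]
  · intro x
    rw [Fin.append_right, Matrix.mul_assoc, hQE, Matrix.mul_zero]

/-- The matrix that maps the `i`-th basis vector to the `σ i`-th one. -/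
def permuteBasis {n : ℕ} (σ : Equiv.Perm (Fin n)) : Matrix (Fin n) (Fin n) ℂ :=
  Matrix.of fun j i => if j = σ i then 1 else 0

lemma permuteBasis_conjTranspose_mul {n : ℕ} (σ : Equiv.Perm (Fin n)) :
    (permuteBasis σ)ᴴ * permuteBasis σ = 1 := by
  ext i j
  simp [permuteBasis, mul_apply, one_apply, eq_comm]

lemma permuteBasis_mul_transpose {n : ℕ} (σ : Equiv.Perm (Fin n)) :
    permuteBasis σ * (permuteBasis σ)ᵀ = 1 := by
  have h : (permuteBasis σ)ᴴ = (permuteBasis σ)ᵀ := by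
    ext i j
    simp [permuteBasis, apply_ite]
  rw [← h, mul_eq_one_comm, permuteBasis_conjTranspose_mul]

lemma rankOneOp_zero {a b : ℕ} : rankOneOp (0 : Matrix (Fin a) (Fin b) ℂ) = 0 := by
  ext; simp [rankOneOp]

lemma rankOneOp_sqrt_smul {a b : ℕ} {p : ℝ} (hp : 0 ≤ p) (A : Matrix (Fin a) (Fin b) ℂ) :
    rankOneOp (((Real.sqrt p : ℝ) : ℂ) • A) = (p : ℂ) • rankOneOp A := by
  ext x y
  have : ((Real.sqrt p : ℝ) : ℂ) * (Real.sqrt p : ℝ) = p := by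
    rw [← Complex.ofReal_mul, Real.mul_self_sqrt hp]
  simp only [rankOneOp, of_apply, Matrix.smul_apply, smul_eq_mul, star_mul', Complex.star_def,
    Complex.conj_ofReal, ← this]
  ring

/-- Nielsen's measurement operators, in the Schmidt bases: weighted by `p s` and for the
permutation `σ s` they convert the Schmidt vector `v` into `w`. -/
lemma exists_nielsen_operators {n k : ℕ} {v w : Fin n → ℝ} (hv0 : ∀ i, 0 ≤ v i)
    (hw0 : ∀ i, 0 ≤ w i) {p : Fin k → ℝ} {σ : Fin k → Equiv.Perm (Fin n)} (hp : ∀ s, 0 ≤ p s)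
    (h : ∀ i, ∑ s, p s * w (σ s i) = v i) :
    ∃ (X : Fin k → Matrix (Fin n) (Fin n) ℂ) (P : Matrix (Fin n) (Fin n) ℂ), Pᴴ = P ∧ P * P = P ∧
      ∑ s, (X s)ᴴ * X s = P ∧
      P * diagonal (fun i => ((Real.sqrt (v i) : ℝ) : ℂ)) =
        diagonal (fun i => ((Real.sqrt (v i) : ℝ) : ℂ)) ∧
      ∀ s, X s * diagonal (fun i => ((Real.sqrt (v i) : ℝ) : ℂ)) =
        ((Real.sqrt (p s) : ℝ) : ℂ) •
          (diagonal (fun i => ((Real.sqrt (w i) : ℝ) : ℂ)) * permuteBasis (σ s)) := by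
  -- `X s` is `√(p s) √w · permutation · 1/√v`. Division by zero gives 0, so the operators resolve
  -- only the projection `P` onto the support of `v`.
  refine ⟨fun s => Matrix.of fun j i => if j = σ s i then
    ((Real.sqrt (p s) * Real.sqrt (w j) / Real.sqrt (v i) : ℝ) : ℂ) else 0,
    diagonal fun i => if v i = 0 then 0 else 1, ?_, ?_, ?_, ?_, ?_⟩
  · rw [diagonal_conjTranspose]
    congr 1
    ext i
    by_cases hi : v i = 0 <;> simp [hi]
  · rw [diagonal_mul_diagonal]
    congr 1
    ext i
    split_ifs <;> simp
  · have hX : ∀ s, (Matrix.of fun j i => if j = σ s i then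
        ((Real.sqrt (p s) * Real.sqrt (w j) / Real.sqrt (v i) : ℝ) : ℂ) else 0)ᴴ *
        (Matrix.of fun j i => if j = σ s i then
        ((Real.sqrt (p s) * Real.sqrt (w j) / Real.sqrt (v i) : ℝ) : ℂ) else 0) =
        diagonal fun i => ((p s * w (σ s i) / v i : ℝ) : ℂ) := by
      intro s
      ext i j
      rw [mul_apply, Finset.sum_eq_single (σ s i) (fun x _ hx => by simp [hx]) (by simp)]
      rcases eq_or_ne i j with rfl | hij
      · simp only [conjTranspose_apply, of_apply, if_true, diagonal_apply_eq, Complex.star_def,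
          Complex.conj_ofReal]
        rw [← Complex.ofReal_mul, div_mul_div_comm, Real.mul_self_sqrt (hv0 i), mul_mul_mul_comm,
          Real.mul_self_sqrt (hp s), Real.mul_self_sqrt (hw0 _)]
      · simp [hij]
    simp only [hX]
    ext i j
    rw [Matrix.sum_apply]
    rcases eq_or_ne i j with rfl | hij
    · simp only [diagonal_apply_eq]
      rw [← Complex.ofReal_sum, ← Finset.sum_div, h i]
      by_cases hi : v i = 0 <;> simp [hi]
    · simp [hij]
  · rw [diagonal_mul_diagonal]
    congr 1
    ext i
    by_cases hi : v i = 0 <;> simp [hi]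
  · intro s
    ext j i
    rw [mul_diagonal, Matrix.smul_apply, diagonal_mul]
    simp only [permuteBasis, of_apply]
    split_ifs with hj
    · subst hj
      rw [← Complex.ofReal_mul, mul_one, smul_eq_mul, ← Complex.ofReal_mul]
      congr 1
      by_cases hi : v i = 0
      -- A zero entry of `v` is a sum of nonnegative terms, so each `p s * w (σ s i)` vanishes too.
      · have := h i
        rw [hi, Finset.sum_eq_zero_iff_of_nonneg (fun s _ => mul_nonneg (hp s) (hw0 _))] at this
        rw [← Real.sqrt_mul (hp s), this s (Finset.mem_univ s)]
        simp
      · exact div_mul_cancel₀ _ (by simpa [Real.sqrt_eq_zero (hv0 i)] using hi)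
    · simp

/-- Nielsen's theorem: majorization suffices for a conversion by LOCC. -/
lemma exists_protocol_of_tailSum_le {O : Type} (o : O) {n a b a' b' : ℕ} {v w : Fin n → ℝ}
    {ψ : BipartiteSpace a b} {φ : BipartiteSpace a' b'} (hψ : ‖ψ‖ = 1) (hφ : ‖φ‖ = 1)
    (hv : IsSchmidtVector v ψ) (hw : IsSchmidtVector w φ)
    (h : ∀ l, tailSum l w ≤ tailSum l v) :
    ∃ T : LOCCProtocol O a' b' a b, T.branch o (pureDensity ψ) = pureDensity φ := by
  obtain ⟨E, F, hE, hF, hψE⟩ := hv.exists_matrix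
  obtain ⟨E', F', hE', hF', hφE⟩ := hw.exists_matrix
  have hv1 : ∑ i, v i = 1 := by
    rw [← frobSq_schmidtMatrix hv.2.1 hE hF, ← hψE, ← norm_sq_eq_frobSq, hψ, one_pow]
  have hw1 : ∑ i, w i = 1 := by
    rw [← frobSq_schmidtMatrix hw.2.1 hE' hF', ← hφE, ← norm_sq_eq_frobSq, hφ, one_pow]
  have hpos : 0 < a' ∧ 0 < b' := by
    by_contra hcon
    have : IsEmpty (Fin a' × Fin b') := by
      rw [isEmpty_prod, ← not_nonempty_iff, ← not_nonempty_iff, ← Fin.pos_iff_nonempty,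
        ← Fin.pos_iff_nonempty]
      tauto
    rw [Subsingleton.elim φ 0, norm_zero] at hφ
    exact zero_ne_one hφ
  obtain ⟨k, p, σ, hp, hp1, hpv⟩ := exists_perm_mixture hv.1 h (hv1.trans hw1.symm)
  obtain ⟨X, P, hP, hPP, hXP, hPS, hXS⟩ := exists_nielsen_operators hv.2.1 hw.2.1 hp hpv
  obtain ⟨N, hN, hNE, hN0⟩ := exists_kraus_completion hpos.1 hE hE' X hP hPP hXP
  -- Alice's completing outcomes annihilate the source, so Bob's reply to them is arbitrary.
  let τ : Fin (k + a) → Equiv.Perm (Fin n) := Fin.append σ fun _ => 1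
  choose R hR hRF hR0 using fun i => exists_kraus_completion (k := 1) hpos.2 hF hF'
    (fun _ => permuteBasis (τ i)) (P := 1) (by simp) (by simp)
    (by simp [permuteBasis_conjTranspose_mul])
  refine ⟨.alice (fun _ => a') N hN fun i => .bob (fun _ => b') (R i) (hR i) fun _ => .done o, ?_⟩
  change LOCCProtocol.branch o _ (rankOneOp (coeffMatrix ψ)) = rankOneOp (coeffMatrix φ)
  simp only [LOCCProtocol.branch, kronecker_mul_rankOneOp, if_true, Matrix.one_mul,
    transpose_one, Matrix.mul_one]
  have hA : ∀ i, N i * coeffMatrix ψ =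
      N i * (E * P) * diagonal (fun i => ((Real.sqrt (v i) : ℝ) : ℂ)) * Fᵀ := fun i => by
    rw [hψE, schmidtMatrix]
    conv_lhs => rw [← hPS]
    simp only [Matrix.mul_assoc]
  have hzero : ∀ x, N (Fin.natAdd k x) * coeffMatrix ψ = 0 := fun x => by
    rw [hA, hN0]
    simp
  have hs : ∀ s, N (Fin.castAdd a s) * coeffMatrix ψ = ((Real.sqrt (p s) : ℝ) : ℂ) •
      (E' * diagonal (fun i => ((Real.sqrt (w i) : ℝ) : ℂ)) * permuteBasis (σ s) * Fᵀ) := fun s => by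
    rw [hψE, schmidtMatrix, ← Matrix.mul_assoc, ← Matrix.mul_assoc, hNE, Matrix.mul_assoc E', hXS]
    simp [Matrix.mul_assoc]
  have hτ : ∀ s, τ (Fin.castAdd a s) = σ s := fun s => Fin.append_left _ _ _
  rw [Fin.sum_univ_add]
  simp only [hzero, Matrix.zero_mul, rankOneOp_zero, Finset.sum_const_zero, add_zero, hs,
    Matrix.smul_mul, rankOneOp_sqrt_smul (hp _), ← Finset.smul_sum]
  have h1 : ∀ s, E' * diagonal (fun i => ((Real.sqrt (w i) : ℝ) : ℂ)) * permuteBasis (σ s) * Fᵀ *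
      (R (Fin.castAdd a s) (Fin.castAdd b default))ᵀ = coeffMatrix φ := fun s => by
    rw [Matrix.mul_assoc _ Fᵀ, ← transpose_mul, hRF, hτ, transpose_mul, ← Matrix.mul_assoc,
      Matrix.mul_assoc _ (permuteBasis (σ s)), permuteBasis_mul_transpose, Matrix.mul_one, hφE,
      schmidtMatrix]
  have h2 : ∀ s x, E' * diagonal (fun i => ((Real.sqrt (w i) : ℝ) : ℂ)) * permuteBasis (σ s) * Fᵀ *
      (R (Fin.castAdd a s) (Fin.natAdd 1 x))ᵀ = 0 := fun s x => by
    have := hR0 (Fin.castAdd a s) x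
    rw [Matrix.mul_one] at this
    rw [Matrix.mul_assoc _ Fᵀ, ← transpose_mul, this, transpose_zero, Matrix.mul_zero]
  simp only [Fin.sum_univ_add, Finset.univ_unique, Finset.sum_singleton, h1, h2, rankOneOp_zero,
    Finset.sum_const_zero, add_zero]
  rw [← Finset.sum_smul, ← Complex.ofReal_sum, hp1, Complex.ofReal_one, one_smul]

/-! ### Both conversion criteria as majorization -/

lemma accesses_iff_tailSum_le {n a b a' b' : ℕ} {v w : Fin n → ℝ}
    {ψ : BipartiteSpace a b} {φ : BipartiteSpace a' b'} (hψ : ‖ψ‖ = 1) (hφ : ‖φ‖ = 1)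
    (hv : IsSchmidtVector v ψ) (hw : IsSchmidtVector w φ) :
    Accesses ψ φ ↔ ∀ l, tailSum l w ≤ tailSum l v := by
  refine ⟨?_, fun h => ?_⟩
  · rintro ⟨_, ⟨T, rfl⟩, hT⟩ l
    have := mul_tailSum_le_of_branch (p := 1) hφ hv hw (by simpa using hT) l
    rwa [one_mul] at this
  · obtain ⟨T, hT⟩ := exists_protocol_of_tailSum_le () hψ hφ hv hw h
    exact ⟨_, ⟨T, rfl⟩, hT⟩

lemma IsSchmidtVector.sum_eq {n a b : ℕ} {v : Fin n → ℝ} {ψ : BipartiteSpace a b}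
    (hv : IsSchmidtVector v ψ) : ∑ i, v i = ‖ψ‖ ^ 2 := by
  obtain ⟨E, F, hE, hF, h⟩ := hv.exists_matrix
  rw [norm_sq_eq_frobSq, h, frobSq_schmidtMatrix hv.2.1 hE hF]

lemma sloccProb_eq_one_iff_tailSum_le {n a b a' b' : ℕ} {v w : Fin n → ℝ}
    {ψ : BipartiteSpace a b} {φ : BipartiteSpace a' b'} (hψ : ‖ψ‖ = 1) (hφ : ‖φ‖ = 1)
    (hv : IsSchmidtVector v ψ) (hw : IsSchmidtVector w φ) :
    sloccProb ψ φ = 1 ↔ ∀ l, tailSum l w ≤ tailSum l v := by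
  have hle : ∀ p, ConvertsWithProb ψ φ p → ∀ l, p * tailSum l w ≤ tailSum l v :=
    fun p ⟨_, hT⟩ => mul_tailSum_le_of_branch hφ hv hw hT
  refine ⟨fun h l => ?_, fun h => ?_⟩
  · rcases (tailSum_nonneg l hw.2.1).eq_or_lt with h0 | h0
    · rw [← h0]
      exact tailSum_nonneg l hv.2.1
    -- An empty set would have the default supremum 0, not 1.
    · have hne : {p : ℝ | ConvertsWithProb ψ φ p}.Nonempty := by
        rw [Set.nonempty_iff_ne_empty]
        intro he
        rw [sloccProb, he, Real.sSup_empty] at h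
        exact zero_ne_one h
      have := csSup_le hne fun p hp => (le_div_iff₀ h0).mpr (hle p hp l)
      rw [← sloccProb, h, one_le_div h0] at this
      exact this
  · obtain ⟨T, hT⟩ := exists_protocol_of_tailSum_le true hψ hφ hv hw h
    refine IsGreatest.csSup_eq ⟨⟨T, by simpa using hT⟩, fun p hp => ?_⟩
    -- At `l = 0` both tail sums are 1, so `p ≤ 1`.
    have := hle p hp 0
    rw [tailSum_zero, tailSum_zero, hv.sum_eq, hw.sum_eq, hψ, hφ] at this
    linarith

lemma measurable_tailSum {n : ℕ} {Ω : Type*} [MeasurableSpace Ω] {v : Ω → Fin n → ℝ}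
    (hv : Measurable v) (l : ℕ) : Measurable fun ω => tailSum l (v ω) := by
  refine Finset.measurable_fun_sum _ fun i _ => ?_
  split_ifs
  · exact (measurable_pi_apply i).comp hv
  · exact measurable_const

theorem mainTheorem4 (n a b a' b' : ℕ) :
    (∀ (v w : Fin n → ℝ) (ψ : BipartiteSpace a b) (φ : BipartiteSpace a' b'),
      ‖ψ‖ = 1 → ‖φ‖ = 1 → IsSchmidtVector v ψ → IsSchmidtVector w φ →
        (Accesses ψ φ ↔ sloccProb ψ φ = 1)) ∧
    (∀ {Ω : Type*} [MeasurableSpace Ω] (μ : Measure Ω) [IsProbabilityMeasure μ]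
      (v w : Ω → Fin n → ℝ) (ψ : Ω → BipartiteSpace a b) (φ : Ω → BipartiteSpace a' b'),
      Measurable v → Measurable w → IndepFun v w μ →
      (∀ ω, ‖ψ ω‖ = 1) → (∀ ω, ‖φ ω‖ = 1) →
      (∀ ω, IsSchmidtVector (v ω) (ψ ω)) → (∀ ω, IsSchmidtVector (w ω) (φ ω)) →
        MeasurableSet {ω | Accesses (ψ ω) (φ ω)} ∧
        {ω | Accesses (ψ ω) (φ ω)} = {ω | sloccProb (ψ ω) (φ ω) = 1} ∧
        μ {ω | Accesses (ψ ω) (φ ω)} = μ {ω | sloccProb (ψ ω) (φ ω) = 1}) := by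
  have key : ∀ (v w : Fin n → ℝ) (ψ : BipartiteSpace a b) (φ : BipartiteSpace a' b'),
      ‖ψ‖ = 1 → ‖φ‖ = 1 → IsSchmidtVector v ψ → IsSchmidtVector w φ →
        (Accesses ψ φ ↔ sloccProb ψ φ = 1) := fun v w ψ φ hψ hφ hv hw =>
    (accesses_iff_tailSum_le hψ hφ hv hw).trans (sloccProb_eq_one_iff_tailSum_le hψ hφ hv hw).symm
  refine ⟨key, ?_⟩
  intro Ω _ μ _ v w ψ φ hvm hwm _ hψ hφ hv hw
  have hset : {ω | Accesses (ψ ω) (φ ω)} = {ω | sloccProb (ψ ω) (φ ω) = 1} :=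
    Set.ext fun ω => key _ _ _ _ (hψ ω) (hφ ω) (hv ω) (hw ω)
  refine ⟨?_, hset, by rw [hset]⟩
  -- The event depends on the states only through their Schmidt vectors, so the state maps
  -- themselves need not be measurable.
  have hmaj : {ω | Accesses (ψ ω) (φ ω)} = ⋂ l, {ω | tailSum l (w ω) ≤ tailSum l (v ω)} := by
    ext ω
    rw [Set.mem_iInter]
    exact accesses_iff_tailSum_le (hψ ω) (hφ ω) (hv ω) (hw ω)
  rw [hmaj]
  exact MeasurableSet.iInter fun l =>
    measurableSet_le (measurable_tailSum hwm l) (measurable_tailSum hvm l)
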